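/- Let $G$ be a finite simple graph with vertex set $V$, let $K$ be a field, and let $S=K[x_v : v\in V]$ with its standard grading. Let $I(G)=(x_ux_v : \{u,v\}\in E(G))$ be the edge ideal of $G$ and $J(G)=\bigl(\prod_{v\in w}x_v : w \text{ an inclusion-minimal vertex cover of } G\bigr)$ its cover ideal. For an ideal $I$ of $S$ and $s\ge 1$, let $I^{(s)}=\bigcap_{\mathfrak p\in\operatorname{Ass}(S/I)}(I^sS_{\mathfrak p}\cap S)$ be the $s$-th symbolic power. For a finitely generated graded $S$-module $M=\bigoplus_{k\ge 0}M_k$ of dimension $d$, write its Hilbert series as $\sum_k \dim_K(M_k)t^k=h_M(t)/(1-t)^d$ with $h_M\in\mathbb Z[t]$; the multiplicity of $M$ is $e(M)=h_M(1)$ (and $e(0)=0$). Let $h$ be the size of a smallest vertex cover of $G$. Then for all $s\ge 1$: (i) $e\bigl(S/I(G)^{(s)}\bigr)=\binom{h+s-1}{h}\,\mathcal V(G)$, where $\mathcal V(G)$ is the number of minimal vertex covers of $G$ of size $h$; (ii) $e\bigl(S/J(G)^{(s)}\bigr)=\binom{s+1}{2}\,|E(G)|$. -/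

import Mathlib

noncomputable section

/-- The Hilbert series `∑ₖ dim_K (Mₖ) tᵏ` of a graded `K`-vector space `M = ⨁ₖ Mₖ`, the family of
graded pieces being `ℳ`. -/
def hilbertSeries (K : Type*) [Field K] {M : Type*} [AddCommGroup M] [Module K M]
    (ℳ : ℕ → Submodule K M) : PowerSeries ℤ :=
  PowerSeries.mk fun k => (Module.finrank K (ℳ k) : ℤ)

/-- The (Krull) dimension of an `R`-module as a natural number; it is set to `0` for the zero
module, and is only used when the dimension is finite. -/
def moduleDim (R : Type*) [CommRing R] (M : Type*) [AddCommGroup M] [Module R M] : ℕ :=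
  ((Module.supportDim R M).unbotD 0).toNat

/-- Let `M` be a finite graded module over the polynomial ring `S = K[x_v : v ∈ σ]`, with graded
pieces `ℳ`. `HasMultiplicity ℳ e` says that `e(M) = e`: there is a polynomial `h` with integer
coefficients such that `H(M, t) = h(t) / (1 - t) ^ d`, where `d` is the dimension of `M`, and
`e = h(1)`. (For `M = 0` this gives `h = 0` and `e = 0`.) -/
def HasMultiplicity {σ K : Type*} [Field K] {M : Type*} [AddCommGroup M] [Module K M]
    [Module (MvPolynomial σ K) M] (ℳ : ℕ → Submodule K M) (e : ℤ) : Prop :=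
  ∃ h : Polynomial ℤ,
    (1 - PowerSeries.X) ^ moduleDim (MvPolynomial σ K) M * hilbertSeries K ℳ
      = (h : PowerSeries ℤ) ∧
    h.eval 1 = e

/-- The multiplicity is unique. -/
theorem HasMultiplicity.unique {σ K : Type*} [Field K] {M : Type*} [AddCommGroup M] [Module K M]
    [Module (MvPolynomial σ K) M] {ℳ : ℕ → Submodule K M} {e e' : ℤ}
    (he : HasMultiplicity (σ := σ) ℳ e) (he' : HasMultiplicity (σ := σ) ℳ e') : e = e' := by
  obtain ⟨h, h1, rfl⟩ := he
  obtain ⟨h', h1', rfl⟩ := he'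
  have : h = h' := Polynomial.coe_injective ℤ (h1.symm.trans h1')
  rw [this]

/-- The standard grading of `S / I`: the piece of degree `k` is the image of the space of
homogeneous polynomials of degree `k`. (`I` is meant to be a homogeneous ideal.) -/
def quotientGrading {σ K : Type*} [Field K] (I : Ideal (MvPolynomial σ K)) (k : ℕ) :
    Submodule K (MvPolynomial σ K ⧸ I) :=
  (MvPolynomial.homogeneousSubmodule σ K k).map (Ideal.Quotient.mkₐ K I).toLinearMap

/-- The `s`-th symbolic power `I^(s) = ⋂_{𝔭 ∈ Ass(R/I)} (I^s R_𝔭 ∩ R)`. -/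
def symbolicPower {R : Type*} [CommRing R] (I : Ideal R) (s : ℕ) : Ideal R :=
  ⨅ p : associatedPrimes R (R ⧸ I),
    haveI : p.1.IsPrime := p.2.isPrime
    ((I ^ s).map (algebraMap R (Localization.AtPrime p.1))).comap
      (algebraMap R (Localization.AtPrime p.1))

namespace SimpleGraph

/-- The edge ideal `I(G) = (x_i x_j : {i, j} ∈ E(G))`. -/
def edgeIdeal (K : Type*) [Field K] {V : Type*} (G : SimpleGraph V) : Ideal (MvPolynomial V K) :=
  Ideal.span {f | ∃ i j : V, G.Adj i j ∧ f = MvPolynomial.X i * MvPolynomial.X j}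

/-- The cover ideal `J(G) = (∏_{v ∈ w} x_v : w a minimal vertex cover of G)`, minimality being with
respect to inclusion. -/
def coverIdeal (K : Type*) [Field K] {V : Type*} (G : SimpleGraph V) : Ideal (MvPolynomial V K) :=
  Ideal.span {f | ∃ w : Finset V, Minimal G.IsVertexCover (w : Set V) ∧
    f = ∏ v ∈ w, MvPolynomial.X v}

end SimpleGraph

end

/-! Write P_C for the prime generated by the variables in C. Both ideals are intersections of primes
P_C over an antichain of sets C: the minimal vertex covers for I(G), the edges for J(G). Their
associated primes are these P_C, and localizing at P_C inverts the variables outside C, so the s-th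
symbolic power is the intersection of the P_C^s (`symbolicPower_inf_orderIdeal`). Defining P_C^s by
the T-adic order in K[x][T] makes primality and cancellation consequences of T being prime.

Modulo this intersection a basis is given by the monomials x^m with ∑_{v ∈ C} m_v < s for some C.
The condition depends only on the truncations b_v = min(m_v, s), so the Hilbert series is the finite
sum of t^|b| / (1-t)^#{v : b_v = s} over admissible b. With n = |V| and h the least size of a C, the
dimension is n - h. After multiplying by (1-t)^(n-h) and setting t = 1, only the b with exactly n -
h coordinates equal to s survive. These come from a unique C of size h: b is s off C and has sum < s
on C, which gives binom(h+s-1, h) vectors for each such C. Edges are the case h = 2. -/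

/-- The homomorphism `K[x] → K[x][T]` multiplying the variables in `C` by `T`. -/
noncomputable def MvPolynomial.scaleHom (K : Type*) [Field K] {V : Type*} (C : Finset V) :
    MvPolynomial V K →ₐ[K] Polynomial (MvPolynomial V K) :=
  open Classical in
  MvPolynomial.aeval fun v =>
    Polynomial.C (MvPolynomial.X v) * (if v ∈ C then Polynomial.X else 1)

/-- The polynomials all of whose monomials have degree at least `s` in the variables in `C`,
that is, the `s`-th power of the monomial prime generated by these variables. -/
noncomputable def MvPolynomial.orderIdeal (K : Type*) [Field K] {V : Type*} (C : Finset V) (s : ℕ) :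
    Ideal (MvPolynomial V K) :=
  (Ideal.span {Polynomial.X ^ s}).comap (MvPolynomial.scaleHom K C)

/-! ### Powers of monomial primes. -/

namespace MvPolynomial

variable {K : Type*} [Field K] {V : Type*} {C D : Finset V} {s : ℕ}

theorem mem_orderIdeal_iff_dvd {f : MvPolynomial V K} :
    f ∈ orderIdeal K C s ↔ Polynomial.X ^ s ∣ scaleHom K C f := by
  rw [orderIdeal, Ideal.mem_comap, Ideal.mem_span_singleton]

theorem scaleHom_monomial [Fintype V] (m : V →₀ ℕ) (c : K) :
    scaleHom K C (monomial m c) =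
      Polynomial.C (monomial m c) * Polynomial.X ^ (∑ v ∈ C, m v) := by
  classical
  rw [scaleHom, aeval_monomial, monomial_eq, Finsupp.prod_fintype _ _ (by simp),
    Finsupp.prod_fintype _ _ (by simp)]
  simp only [mul_pow, Finset.prod_mul_distrib, ite_pow, one_pow, Finset.prod_ite_mem,
    Finset.univ_inter, Finset.prod_pow_eq_pow_sum, map_mul, map_prod, map_pow, mul_assoc]
  rfl

theorem coeff_coeff_scaleHom [Fintype V] (f : MvPolynomial V K) (d : ℕ) (m : V →₀ ℕ) :
    coeff m ((scaleHom K C f).coeff d) = if ∑ v ∈ C, m v = d then coeff m f else 0 := by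
  classical
  induction f using MvPolynomial.induction_on' with
  | monomial u a =>
    rw [scaleHom_monomial, Polynomial.coeff_C_mul, Polynomial.coeff_X_pow]
    by_cases h : u = m
    · subst h; split_ifs <;> simp_all
    · split_ifs <;> simp [coeff_monomial, h]
  | add p q hp hq =>
    rw [map_add, Polynomial.coeff_add, coeff_add, hp, hq, coeff_add]
    split_ifs <;> simp

theorem mem_orderIdeal [Fintype V] {f : MvPolynomial V K} :
    f ∈ orderIdeal K C s ↔ ∀ m, ∑ v ∈ C, m v < s → coeff m f = 0 := by
  rw [mem_orderIdeal_iff_dvd, Polynomial.X_pow_dvd_iff]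
  constructor
  · intro h m hm
    have := congrArg (coeff m) (h _ hm)
    rwa [coeff_coeff_scaleHom, if_pos rfl, coeff_zero] at this
  · intro h d hd
    ext m
    rw [coeff_coeff_scaleHom, coeff_zero]
    split_ifs with hm
    · exact h m (hm ▸ hd)
    · rfl

theorem monomial_mem_orderIdeal [Fintype V] {m : V →₀ ℕ} {c : K} (h : s ≤ ∑ v ∈ C, m v) :
    monomial m c ∈ orderIdeal K C s := by
  classical
  rw [mem_orderIdeal]
  intro m' hm'
  rw [coeff_monomial, if_neg]
  rintro rfl
  omega

theorem X_mem_orderIdeal [Fintype V] {v : V} : (X v : MvPolynomial V K) ∈ orderIdeal K C 1 ↔ v ∈ C := by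
  classical
  constructor
  · intro h
    by_contra hv
    have := mem_orderIdeal.1 h (Finsupp.single v 1) (by
      simp [Finsupp.single_apply, hv])
    simp at this
  · intro h
    refine monomial_mem_orderIdeal ?_
    simp [Finsupp.single_apply, h]

instance isPrime_orderIdeal_one : (orderIdeal K C 1).IsPrime := by
  have : (Ideal.span {(Polynomial.X ^ 1 : Polynomial (MvPolynomial V K))}).IsPrime := by
    rw [pow_one, Ideal.span_singleton_prime Polynomial.X_ne_zero]
    exact Polynomial.prime_X
  exact Ideal.comap_isPrime _ _

theorem orderIdeal_one_le [Fintype V] : orderIdeal K C 1 ≤ orderIdeal K D 1 ↔ C ⊆ D := by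
  constructor
  · intro h v hv
    exact X_mem_orderIdeal.1 (h (X_mem_orderIdeal.2 hv))
  · intro h f hf
    rw [mem_orderIdeal] at hf ⊢
    intro m hm
    exact hf m (lt_of_le_of_lt (Finset.sum_le_sum_of_subset h) hm)

theorem mul_mem_orderIdeal {t : ℕ} {f g : MvPolynomial V K} (hf : f ∈ orderIdeal K C s)
    (hg : g ∈ orderIdeal K C t) : f * g ∈ orderIdeal K C (s + t) := by
  rw [mem_orderIdeal_iff_dvd] at hf hg ⊢
  rw [map_mul, pow_add]
  exact mul_dvd_mul hf hg

theorem orderIdeal_one_pow_le : orderIdeal K C 1 ^ s ≤ orderIdeal K C s := by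
  induction s with
  | zero =>
    intro f _
    rw [mem_orderIdeal_iff_dvd, pow_zero]
    exact one_dvd _
  | succ t ih =>
    rw [pow_succ, Ideal.mul_le]
    exact fun f hf g hg => mul_mem_orderIdeal (ih hf) hg

/-- T is prime in K[x][T], so a factor not divisible by T cancels: P_C^s is P_C-primary. -/
theorem mem_orderIdeal_of_mul_mem {f g : MvPolynomial V K} (hg : g ∉ orderIdeal K C 1)
    (h : g * f ∈ orderIdeal K C s) : f ∈ orderIdeal K C s := by
  rw [mem_orderIdeal_iff_dvd] at *
  rw [map_mul] at h
  exact Polynomial.prime_X.pow_dvd_of_dvd_mul_left s (by simpa using hg) h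

theorem monomial_mem_span_X_pow [Fintype V] (m : V →₀ ℕ) (c : K) (h : s ≤ ∑ v ∈ C, m v) :
    monomial m c ∈ Ideal.span (X '' (C : Set V) : Set (MvPolynomial V K)) ^ s := by
  refine Ideal.pow_le_pow_right h ?_
  rw [monomial_eq, Finsupp.prod_fintype _ _ (by simp), ← Finset.prod_pow_eq_pow_sum]
  refine Ideal.mul_mem_left _ _ ?_
  classical
  rw [← Finset.prod_mul_prod_compl C]
  refine Ideal.mul_mem_right _ _ (Ideal.prod_mem_prod fun v hv => ?_)
  exact Ideal.pow_mem_pow (Ideal.subset_span (Set.mem_image_of_mem _ hv)) _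

theorem orderIdeal_eq_span_pow [Fintype V] :
    orderIdeal K C s = Ideal.span (X '' (C : Set V) : Set (MvPolynomial V K)) ^ s := by
  apply le_antisymm
  · intro f hf
    rw [mem_orderIdeal] at hf
    rw [f.as_sum]
    refine Ideal.sum_mem _ fun m hm => monomial_mem_span_X_pow m _ ?_
    by_contra hlt
    exact (mem_support_iff.1 hm) (hf m (not_le.1 hlt))
  · refine le_trans (Ideal.pow_right_mono ?_ s) orderIdeal_one_pow_le
    rw [Ideal.span_le]
    rintro _ ⟨v, hv, rfl⟩
    exact X_mem_orderIdeal.2 hv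

/-! ### Symbolic powers of intersections of monomial primes. -/

section Inf

variable [Fintype V] {𝒞 : Finset (Finset V)}

theorem mem_inf_orderIdeal {f : MvPolynomial V K} :
    f ∈ 𝒞.inf (fun C => orderIdeal K C s) ↔
      ∀ m : V →₀ ℕ, (∃ C ∈ 𝒞, ∑ v ∈ C, m v < s) → coeff m f = 0 := by
  rw [Submodule.mem_finsetInf]
  simp only [mem_orderIdeal]
  constructor
  · rintro h m ⟨C, hC, hm⟩
    exact h C hC m hm
  · intro h C hC m hm
    exact h m ⟨C, hC, hm⟩

/-- By the antichain property, any other D has a variable outside C, and it divides the product. -/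
theorem X_mul_prod_compl_mem [DecidableEq V] (h𝒞 : IsAntichain (· ⊆ ·) (𝒞 : Set (Finset V)))
    (hC : C ∈ 𝒞) {v : V} (hv : v ∈ C) :
    (X v * ∏ w ∈ Cᶜ, X w : MvPolynomial V K) ∈ 𝒞.inf (fun C => orderIdeal K C 1) := by
  rw [Submodule.mem_finsetInf]
  intro D hD
  by_cases hCD : C = D
  · subst hCD
    exact Ideal.mul_mem_right _ _ (X_mem_orderIdeal.2 hv)
  · obtain ⟨w, hw, hwC⟩ := Finset.not_subset.1 (h𝒞 hD hC (Ne.symm hCD))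
    refine Ideal.mul_mem_left _ _ (Ideal.mem_of_dvd _ (Finset.dvd_prod_of_mem _ ?_)
      (X_mem_orderIdeal.2 hw))
    simpa using hwC

theorem prod_compl_notMem [DecidableEq V] :
    (∏ w ∈ Cᶜ, X w : MvPolynomial V K) ∉ orderIdeal K C 1 := by
  rw [Ideal.IsPrime.prod_mem_iff]
  rintro ⟨w, hw, h⟩
  exact (Finset.mem_compl.1 hw) (X_mem_orderIdeal.1 h)

theorem pow_mul_mem [DecidableEq V] (h𝒞 : IsAntichain (· ⊆ ·) (𝒞 : Set (Finset V)))
    (hC : C ∈ 𝒞) {f : MvPolynomial V K} (hf : f ∈ orderIdeal K C s) :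
    (∏ w ∈ Cᶜ, X w) ^ s * f ∈ (𝒞.inf (fun C => orderIdeal K C 1)) ^ s := by
  rw [orderIdeal_eq_span_pow] at hf
  have h : Ideal.span {(∏ w ∈ Cᶜ, X w : MvPolynomial V K)} *
      Ideal.span (X '' (C : Set V) : Set (MvPolynomial V K)) ≤
        𝒞.inf (fun C => orderIdeal K C 1) := by
    rw [Ideal.span_mul_span', Ideal.span_le]
    rintro _ ⟨_, rfl, _, ⟨v, hv, rfl⟩, rfl⟩
    simpa [mul_comm] using X_mul_prod_compl_mem (K := K) h𝒞 hC hv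
  refine Ideal.pow_right_mono h s ?_
  rw [mul_pow]
  exact Ideal.mul_mem_mul (Ideal.pow_mem_pow (Ideal.mem_span_singleton_self _) _) hf

theorem associatedPrimes_quotient_inf_orderIdeal
    (h𝒞 : IsAntichain (· ⊆ ·) (𝒞 : Set (Finset V))) {P : Ideal (MvPolynomial V K)} :
    P ∈ associatedPrimes (MvPolynomial V K)
        (MvPolynomial V K ⧸ 𝒞.inf (fun C => orderIdeal K C 1)) ↔
      ∃ C ∈ 𝒞, P = orderIdeal K C 1 := by
  classical
  set I := 𝒞.inf (fun C => orderIdeal K C 1) with hI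
  constructor
  · intro hP
    rw [AssociatedPrimes.mem_iff, isAssociatedPrime_iff] at hP
    obtain ⟨hprime, x, hx⟩ := hP
    obtain ⟨x, rfl⟩ := Ideal.Quotient.mk_surjective x
    have hmem : ∀ r, r ∈ P ↔ r * x ∈ I := by
      intro r
      rw [hx, Submodule.mem_colon_singleton, Submodule.mem_bot, ← Ideal.Quotient.eq_zero_iff_mem]
      rfl
    -- The annihilator of x is the intersection of the P_C not containing x; being prime, it equals
    -- one of them.
    have hPeq : P = (𝒞.filter fun C => x ∉ orderIdeal K C 1).inf (fun C => orderIdeal K C 1) := by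
      ext r
      rw [hmem, hI, Submodule.mem_finsetInf, Submodule.mem_finsetInf]
      constructor
      · intro h C hC
        rw [Finset.mem_filter] at hC
        exact (Ideal.IsPrime.mem_or_mem inferInstance (h C hC.1)).resolve_right hC.2
      · intro h C hC
        by_cases hxC : x ∈ orderIdeal K C 1
        · exact Ideal.mul_mem_left _ _ hxC
        · exact Ideal.mul_mem_right _ _ (h C (Finset.mem_filter.2 ⟨hC, hxC⟩))
    rw [hPeq] at hprime
    obtain ⟨C, hC, h⟩ := Ideal.eq_inf_of_isPrime_inf hprime
    exact ⟨C, (Finset.mem_filter.1 hC).1, hPeq.trans h.symm⟩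
  · rintro ⟨C, hC, rfl⟩
    -- The antichain property makes P_C minimal over the intersection.
    apply Module.associatedPrimes.minimalPrimes_annihilator_subset_associatedPrimes
    rw [Ideal.annihilator_quotient]
    refine ⟨⟨inferInstance, Finset.inf_le hC⟩, ?_⟩
    rintro q ⟨hq, hIq⟩ hqC
    obtain ⟨D, hD, hDq⟩ := hq.inf_le'.1 hIq
    have hDC : D = C := h𝒞.eq hD hC (orderIdeal_one_le.1 (hDq.trans hqC))
    exact hDC ▸ hDq

theorem comap_map_pow_atPrime (h𝒞 : IsAntichain (· ⊆ ·) (𝒞 : Set (Finset V))) (hC : C ∈ 𝒞)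
    (P : Ideal (MvPolynomial V K)) [P.IsPrime] (hP : P = orderIdeal K C 1) :
    (((𝒞.inf (fun C => orderIdeal K C 1)) ^ s).map
      (algebraMap (MvPolynomial V K) (Localization.AtPrime P))).comap
        (algebraMap (MvPolynomial V K) (Localization.AtPrime P)) = orderIdeal K C s := by
  classical
  subst hP
  ext f
  rw [Ideal.mem_comap, IsLocalization.algebraMap_mem_map_algebraMap_iff
    (orderIdeal K C 1).primeCompl]
  constructor
  · rintro ⟨y, hy, h⟩
    refine mem_orderIdeal_of_mul_mem hy ?_
    exact orderIdeal_one_pow_le (Ideal.pow_right_mono (Finset.inf_le hC) s h)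
  · intro hf
    exact ⟨_, (orderIdeal K C 1).primeCompl.pow_mem prod_compl_notMem s, pow_mul_mem h𝒞 hC hf⟩

theorem symbolicPower_inf_orderIdeal (h𝒞 : IsAntichain (· ⊆ ·) (𝒞 : Set (Finset V))) :
    symbolicPower (𝒞.inf (fun C => orderIdeal K C 1)) s =
      𝒞.inf (fun C => orderIdeal K C s) := by
  unfold symbolicPower
  apply le_antisymm
  · refine Finset.le_inf fun C hC => ?_
    have hP := (associatedPrimes_quotient_inf_orderIdeal (K := K) h𝒞).2 ⟨C, hC, rfl⟩
    refine (iInf_le _ ⟨_, hP⟩).trans ?_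
    exact (comap_map_pow_atPrime h𝒞 hC _ rfl).le
  · refine le_iInf fun ⟨P, hP⟩ => ?_
    obtain ⟨C, hC, h⟩ := (associatedPrimes_quotient_inf_orderIdeal (K := K) h𝒞).1 hP
    have : P.IsPrime := hP.isPrime
    exact (Finset.inf_le hC).trans (comap_map_pow_atPrime h𝒞 hC P h).ge

end Inf

end MvPolynomial

/-! ### Monomial bases of graded quotients. -/

namespace MvPolynomial

variable {K : Type*} [Field K] {V : Type*} [Fintype V] [DecidableEq V]

/-- If an ideal consists of the polynomials with no monomial in `A`, then the monomials in `A` are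
a basis of the quotient. -/
theorem finrank_quotientGrading {I : Ideal (MvPolynomial V K)} {A : (V →₀ ℕ) → Prop}
    [DecidablePred A] (hI : ∀ f, f ∈ I ↔ ∀ m, A m → coeff m f = 0) (k : ℕ) :
    Module.finrank K (quotientGrading I k) =
      ((Finset.finsuppAntidiag (Finset.univ : Finset V) k).filter A).card := by
  set T := (Finset.finsuppAntidiag (Finset.univ : Finset V) k).filter A with hT
  have hdeg : ∀ m ∈ T, m.degree = k := by
    intro m hm
    rw [hT, Finset.mem_filter, Finset.mem_finsuppAntidiag] at hm
    rw [← hm.1.1, Finsupp.degree_eq_sum]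
  let b : T → quotientGrading I k := fun m =>
    ⟨Ideal.Quotient.mkₐ K I (monomial m.1 1),
      Submodule.mem_map_of_mem ((mem_homogeneousSubmodule _ _).2
        (isHomogeneous_monomial _ (hdeg _ m.2)))⟩
  have hli : LinearIndependent K b := by
    rw [Fintype.linearIndependent_iff]
    intro g hg i
    have h1 : Ideal.Quotient.mkₐ K I (∑ m : T, monomial m.1 (g m)) = 0 := by
      have h2 := congrArg Subtype.val hg
      rw [AddSubmonoidClass.coe_finsetSum] at h2
      rw [map_sum]
      refine Eq.trans (Finset.sum_congr rfl fun m _ => ?_) h2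
      rw [Submodule.coe_smul, ← map_smul, smul_monomial, smul_eq_mul, mul_one]
    have h3 := (hI _).1 (Ideal.Quotient.eq_zero_iff_mem.1 h1) i.1 (Finset.mem_filter.1 i.2).2
    rw [coeff_sum, Finset.sum_eq_single i] at h3
    · simpa using h3
    · intro j _ hji
      rw [coeff_monomial, if_neg fun h => hji (Subtype.ext h)]
    · simp
  have hsp : ⊤ ≤ Submodule.span K (Set.range b) := by
    rintro ⟨_, f, hf, rfl⟩ -
    have hf' : f.IsHomogeneous k := hf
    have h1 : (⟨(Ideal.Quotient.mkₐ K I).toLinearMap f, ⟨f, hf, rfl⟩⟩ : quotientGrading I k) =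
        ∑ m : T, coeff m.1 f • b m := by
      apply Subtype.ext
      rw [AddSubmonoidClass.coe_finsetSum]
      change Ideal.Quotient.mkₐ K I f =
        ∑ m : T, coeff m.1 f • Ideal.Quotient.mkₐ K I (monomial m.1 1)
      rw [Finset.sum_congr rfl fun m _ => (map_smul (Ideal.Quotient.mkₐ K I) _ _).symm, ← map_sum]
      refine Ideal.Quotient.eq.2 ((hI _).2 fun m hm => ?_)
      rw [coeff_sub, coeff_sum]
      simp_rw [smul_monomial, smul_eq_mul, mul_one, coeff_monomial]
      by_cases hmk : m.degree = k
      · have hmT : m ∈ T := by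
          rw [hT, Finset.mem_filter, Finset.mem_finsuppAntidiag]
          exact ⟨⟨by rw [← hmk, Finsupp.degree_eq_sum], Finset.subset_univ _⟩, hm⟩
        rw [Finset.sum_eq_single ⟨m, hmT⟩]
        · simp
        · intro j _ hj
          rw [if_neg fun h => hj (Subtype.ext h)]
        · simp
      · rw [hf'.coeff_eq_zero hmk, Finset.sum_eq_zero, sub_zero]
        intro j _
        rw [if_neg]
        rintro h
        exact hmk (h ▸ hdeg _ j.2)
    rw [h1]
    exact Submodule.sum_mem _ fun m _ =>
      Submodule.smul_mem _ _ (Submodule.subset_span ⟨m, rfl⟩)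
  rw [Module.finrank_eq_card_basis (Module.Basis.mk hli hsp), Fintype.card_coe]

end MvPolynomial

/-! ### Generating functions of truncated exponents. -/

namespace PowerSeries

/-- The generating function `∑ tᵃ` over the `a` with `min a s = j`. -/
noncomputable def truncSeries (s j : ℕ) : PowerSeries ℤ :=
  mk fun a => if min a s = j then 1 else 0

/-- For j < s only a = j contributes; for j = s the series is the tail t^s / (1-t). -/
theorem truncSeries_mul {s j : ℕ} (h : j ≤ s) :
    truncSeries s j * (if j = s then 1 - X else 1) = X ^ j := by
  split_ifs with hj
  · subst hj
    ext n
    rw [mul_sub, mul_one, map_sub]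
    cases n with
    | zero => simp [truncSeries, coeff_X_pow]; grind
    | succ n =>
      rw [coeff_succ_mul_X, truncSeries, coeff_mk, coeff_mk, coeff_X_pow]
      grind
  · ext n
    rw [mul_one, truncSeries, coeff_mk, coeff_X_pow]
    grind

theorem prod_truncSeries_mul {V : Type*} [Fintype V] {s d : ℕ} {b : V → ℕ} (hb : ∀ v, b v ≤ s)
    (hd : (Finset.univ.filter fun v => b v = s).card ≤ d) :
    (1 - X) ^ d * ∏ v, truncSeries s (b v) =
      X ^ (∑ v, b v) * (1 - X) ^ (d - (Finset.univ.filter fun v => b v = s).card) := by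
  have h : (∏ v, truncSeries s (b v)) * (1 - X) ^ (Finset.univ.filter fun v => b v = s).card =
      X ^ (∑ v, b v) := by
    rw [← Finset.prod_const, Finset.prod_filter, ← Finset.prod_mul_distrib,
      Finset.prod_congr rfl fun v _ => truncSeries_mul (hb v), Finset.prod_pow_eq_pow_sum]
  rw [← h, mul_assoc, ← pow_add, Nat.add_sub_cancel' hd, mul_comm]

/-- Every exponent vector has exactly one truncation, and `hA` says that the truncation decides `A`.
-/
theorem coeff_sum_prod_truncSeries {V : Type*} [Fintype V] [DecidableEq V] {s : ℕ}
    (A : (V → ℕ) → Prop) [DecidablePred A] (hA : ∀ a, A a ↔ A fun v => min (a v) s) (k : ℕ) :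
    coeff k (∑ b ∈ (Fintype.piFinset fun _ : V => Finset.range (s + 1)).filter A,
        ∏ v, truncSeries s (b v)) =
      (((Finset.finsuppAntidiag (Finset.univ : Finset V) k).filter fun m : V →₀ ℕ => A m).card : ℤ) := by
  rw [map_sum]
  simp_rw [coeff_prod, truncSeries, coeff_mk, Finset.prod_ite_zero, Finset.prod_const_one]
  rw [Finset.sum_comm, Finset.card_filter, Nat.cast_sum]
  refine Finset.sum_congr rfl fun m _ => ?_
  have h : ∀ b : V → ℕ, (∀ v ∈ Finset.univ, min (m v) s = b v) ↔ (fun v => min (m v) s) = b := by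
    intro b
    simp [funext_iff]
  simp_rw [h]
  rw [Finset.sum_ite_eq]
  have h2 : (fun v => min (m v) s) ∈ Fintype.piFinset fun _ : V => Finset.range (s + 1) := by
    simp [Fintype.mem_piFinset]
  simp [h2, hA m]

end PowerSeries

/-! ### Counting the truncated vectors that survive at t = 1. -/

namespace Finset

variable {V : Type*} [Fintype V] [DecidableEq V] {s : ℕ}

theorem card_filter_eq_off_sum_eq (C : Finset V) {k : ℕ} (hk : k < s) :
    ((Fintype.piFinset fun _ : V => range (s + 1)).filter fun b =>
      (∀ v, v ∉ C → b v = s) ∧ ∑ v ∈ C, b v = k).card = (#C).multichoose k := by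
  rw [← card_finsuppAntidiag_nat_eq_multichoose]
  refine card_bij' (fun b _ => Finsupp.indicator C fun v _ => b v)
    (fun f _ v => if v ∈ C then f v else s) ?_ ?_ ?_ ?_
  · intro b hb
    simp only [mem_filter] at hb
    rw [mem_finsuppAntidiag]
    refine ⟨?_, Finsupp.support_indicator_subset _ _⟩
    rw [← hb.2.2]
    exact sum_congr rfl fun v hv => by simp [Finsupp.indicator_apply, hv]
  · intro f hf
    rw [mem_finsuppAntidiag] at hf
    simp only [mem_filter, Fintype.mem_piFinset, mem_range]
    refine ⟨fun v => ?_, fun v hv => by simp [hv], ?_⟩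
    · split_ifs with hv
      · have h1 : f v ≤ ∑ v ∈ C, f v := single_le_sum (fun _ _ => Nat.zero_le _) hv
        have h2 : ∑ v ∈ C, f v = k := hf.1
        omega
      · omega
    · rw [← hf.1]
      exact sum_congr rfl fun v hv => by simp [hv]
  · intro b hb
    simp only [mem_filter] at hb
    funext v
    by_cases hv : v ∈ C
    · simp [Finsupp.indicator_apply, hv]
    · simp [hv, hb.2.1 v hv]
  · intro f hf
    rw [mem_finsuppAntidiag] at hf
    ext v
    by_cases hv : v ∈ C
    · simp [Finsupp.indicator_apply, hv]
    · simp [Finsupp.indicator_apply, hv, Finsupp.notMem_support_iff.1 fun h => hv (hf.2 h)]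

theorem card_filter_eq_off_sum_lt (C : Finset V) (hs : 1 ≤ s) :
    ((Fintype.piFinset fun _ : V => range (s + 1)).filter fun b =>
      (∀ v, v ∉ C → b v = s) ∧ ∑ v ∈ C, b v < s).card = (#C + s - 1).choose #C := by
  -- Fibering over the sum on C reduces the count to ∑_{k<s} multichoose(#C, k), a hockey-stick sum.
  rw [card_eq_sum_card_fiberwise (f := fun b => ∑ v ∈ C, b v) (t := range s)]
  · rw [sum_congr rfl (g := fun k => (#C).multichoose k)]
    · obtain ⟨n, rfl⟩ : ∃ n, s = n + 1 := ⟨s - 1, by omega⟩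
      rw [Nat.sum_range_multichoose]
      congr 1
      omega
    · intro k hk
      rw [mem_range] at hk
      rw [← card_filter_eq_off_sum_eq C hk, filter_filter]
      congr 1
      refine filter_congr fun b _ => ?_
      constructor
      · rintro ⟨⟨h1, -⟩, h3⟩
        exact ⟨h1, h3⟩
      · rintro ⟨h1, h3⟩
        exact ⟨⟨h1, h3 ▸ hk⟩, h3⟩
  · intro b hb
    simpa using (mem_filter.1 hb).2.2

variable {𝒞 : Finset (Finset V)} {h : ℕ}

theorem card_filter_eq_le {b : V → ℕ} {C : Finset V} (hC : ∑ v ∈ C, b v < s) :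
    #(univ.filter fun v => b v = s) ≤ Fintype.card V - #C := by
  rw [← card_compl]
  refine card_le_card fun v hv => ?_
  rw [mem_compl]
  intro hvC
  have := single_le_sum (f := b) (fun _ _ => Nat.zero_le _) hvC
  have := (mem_filter.1 hv).2
  omega

theorem card_filter_exists_sum_lt (h𝒞 : ∀ C ∈ 𝒞, h ≤ #C) (hs : 1 ≤ s) :
    #((Fintype.piFinset fun _ : V => range (s + 1)).filter fun b =>
      (∃ C ∈ 𝒞, ∑ v ∈ C, b v < s) ∧
        #(univ.filter fun v => b v = s) = Fintype.card V - h) =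
      (h + s - 1).choose h * #(𝒞.filter fun C => #C = h) := by
  have key : ((Fintype.piFinset fun _ : V => range (s + 1)).filter fun b =>
      (∃ C ∈ 𝒞, ∑ v ∈ C, b v < s) ∧
        #(univ.filter fun v => b v = s) = Fintype.card V - h) =
      (𝒞.filter fun C => #C = h).biUnion fun C =>
        (Fintype.piFinset fun _ : V => range (s + 1)).filter fun b =>
          (∀ v, v ∉ C → b v = s) ∧ ∑ v ∈ C, b v < s := by
    ext b
    simp only [mem_filter, mem_biUnion]
    constructor
    · rintro ⟨hb, ⟨C, hC, hlt⟩, hcard⟩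
      have hsub : (univ.filter fun v => b v = s) ⊆ Cᶜ := by
        intro v hv
        rw [mem_compl]
        intro hvC
        have := single_le_sum (f := b) (fun _ _ => Nat.zero_le _) hvC
        have := (mem_filter.1 hv).2
        omega
      have h1 := h𝒞 C hC
      have h2 := card_filter_eq_le hlt
      have h3 := card_le_univ C
      refine ⟨C, ⟨hC, by omega⟩, hb, ?_, hlt⟩
      have heq := eq_of_subset_of_card_le hsub (by rw [card_compl]; omega)
      intro v hv
      have hv' : v ∈ univ.filter fun v => b v = s := by
        rw [heq]
        exact mem_compl.2 hv
      exact (mem_filter.1 hv').2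
    · rintro ⟨C, ⟨hC, rfl⟩, hb, h1, h2⟩
      refine ⟨hb, ⟨C, hC, h2⟩, le_antisymm (card_filter_eq_le h2) ?_⟩
      rw [← card_compl]
      exact card_le_card fun v hv => mem_filter.2 ⟨mem_univ _, h1 v (mem_compl.1 hv)⟩
  rw [key, card_biUnion, sum_congr rfl (g := fun _ => (h + s - 1).choose h), sum_const,
    smul_eq_mul, mul_comm]
  · intro C hC
    rw [card_filter_eq_off_sum_lt C hs, (mem_filter.1 hC).2]
  -- C is recovered from b as the set of coordinates different from s, so distinct C give disjoint
  -- families.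
  · intro C hC D hD hCD
    rw [Function.onFun, disjoint_left]
    intro b hb hb'
    simp only [mem_filter] at hb hb'
    refine hCD (eq_of_subset_of_card_le (fun v hv => ?_)
      (by rw [(mem_filter.1 hC).2, (mem_filter.1 hD).2]))
    by_contra hvD
    have h1 := single_le_sum (f := b) (fun _ _ => Nat.zero_le _) hv
    have h2 := hb'.2.1 v hvD
    have h3 := hb.2.2
    omega

end Finset

/-! ### Hilbert series and multiplicity. -/

namespace MvPolynomial

variable {K : Type*} [Field K] {V : Type*} [Fintype V] [DecidableEq V] {𝒞 : Finset (Finset V)}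
  {h s : ℕ}

theorem hilbertSeries_inf_orderIdeal :
    hilbertSeries K (quotientGrading (𝒞.inf fun C => orderIdeal K C s)) =
      ∑ b ∈ (Fintype.piFinset fun _ : V => Finset.range (s + 1)).filter
        fun b => ∃ C ∈ 𝒞, ∑ v ∈ C, b v < s, ∏ v, PowerSeries.truncSeries s (b v) := by
  ext k
  rw [PowerSeries.coeff_sum_prod_truncSeries, hilbertSeries, PowerSeries.coeff_mk,
    finrank_quotientGrading fun f => mem_inf_orderIdeal]
  intro a
  refine exists_congr fun C => and_congr_right fun _ => ?_
  constructor
  · exact fun hlt => lt_of_le_of_lt (Finset.sum_le_sum fun v _ => min_le_left _ _) hlt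
  · intro (hlt : ∑ v ∈ C, min (a v) s < s)
    -- A truncated sum below s forces each term below s, so nothing on C was truncated.
    rwa [Finset.sum_congr rfl fun v hv => min_eq_left (a := a v) (b := s) ?_] at hlt
    have : min (a v) s ≤ ∑ v ∈ C, min (a v) s :=
      Finset.single_le_sum (f := fun v => min (a v) s) (fun _ _ => Nat.zero_le _) hv
    omega

theorem hasMultiplicity_inf_orderIdeal (h𝒞 : ∀ C ∈ 𝒞, h ≤ C.card) (hs : 1 ≤ s)
    (hdim : moduleDim (MvPolynomial V K) (MvPolynomial V K ⧸ 𝒞.inf fun C => orderIdeal K C s) =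
      Fintype.card V - h) :
    HasMultiplicity (σ := V) (quotientGrading (𝒞.inf fun C => orderIdeal K C s))
      ((h + s - 1).choose h * (𝒞.filter fun C => C.card = h).card : ℕ) := by
  refine ⟨∑ b ∈ (Fintype.piFinset fun _ : V => Finset.range (s + 1)).filter
    fun b => ∃ C ∈ 𝒞, ∑ v ∈ C, b v < s, Polynomial.X ^ (∑ v, b v) * (1 - Polynomial.X) ^
      (Fintype.card V - h - (Finset.univ.filter fun v => b v = s).card), ?_, ?_⟩
  · rw [hdim, hilbertSeries_inf_orderIdeal, Finset.mul_sum, ← Polynomial.coeToPowerSeries.ringHom_apply,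
      map_sum]
    refine Finset.sum_congr rfl fun b hb => ?_
    obtain ⟨hb, C, hC, hlt⟩ := Finset.mem_filter.1 hb
    rw [PowerSeries.prod_truncSeries_mul]
    · simp
    · intro v
      have := Fintype.mem_piFinset.1 hb v
      rw [Finset.mem_range] at this
      omega
    · have := Finset.card_filter_eq_le hlt
      have := h𝒞 C hC
      omega
  · rw [Polynomial.eval_finsetSum, ← Finset.card_filter_exists_sum_lt h𝒞 hs,
      ← Finset.filter_filter, Finset.card_filter, Nat.cast_sum]
    refine Finset.sum_congr rfl fun b hb => ?_
    obtain ⟨hb, C, hC, hlt⟩ := Finset.mem_filter.1 hb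
    have h1 := Finset.card_filter_eq_le hlt
    have h2 := h𝒞 C hC
    simp only [Polynomial.eval_mul, Polynomial.eval_pow, Polynomial.eval_X, one_pow, one_mul,
      Polynomial.eval_sub, Polynomial.eval_one, sub_self]
    split_ifs with heq
    · simp [heq]
    -- Fewer than n - h coordinates equal s, so a positive power of 1 - t remains and vanishes at t
    -- = 1.
    · rw [zero_pow (by omega)]
      simp

end MvPolynomial

/-! ### Krull dimension of the quotient. -/

namespace MvPolynomial

section Dimension

variable {K : Type*} [Field K] {V : Type*} [Fintype V] {𝒞 : Finset (Finset V)} {h s : ℕ}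

theorem ringKrullDim_compl (C : Finset V) :
    ringKrullDim (MvPolynomial {v // v ∉ C} K) = ((Fintype.card V - C.card : ℕ) : WithBot ℕ∞) := by
  classical
  rw [ringKrullDim_of_isNoetherianRing, ringKrullDim_eq_zero_of_field, zero_add,
    Nat.card_eq_fintype_card, Fintype.card_subtype_compl, Fintype.card_coe]

theorem ringKrullDim_quotient_orderIdeal_one_le (C : Finset V) :
    ringKrullDim (MvPolynomial V K ⧸ orderIdeal K C 1) ≤
      ((Fintype.card V - C.card : ℕ) : WithBot ℕ∞) := by
  classical
  rw [← ringKrullDim_compl (K := K)]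
  let φ : MvPolynomial {v // v ∉ C} K →ₐ[K] MvPolynomial V K ⧸ orderIdeal K C 1 :=
    aeval fun v => Ideal.Quotient.mk _ (X v.1)
  refine ringKrullDim_le_of_surjective φ.toRingHom fun y => ?_
  obtain ⟨f, rfl⟩ := Ideal.Quotient.mk_surjective y
  change ∃ a, φ a = _
  induction f using MvPolynomial.induction_on with
  | C c => exact ⟨MvPolynomial.C c, by rw [← algebraMap_eq, AlgHom.commutes]; rfl⟩
  | add p q hp hq =>
    obtain ⟨a, ha⟩ := hp
    obtain ⟨b, hb⟩ := hq
    exact ⟨a + b, by rw [map_add, map_add, ha, hb]⟩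
  | mul_X p v hp =>
    obtain ⟨a, ha⟩ := hp
    by_cases hv : v ∈ C
    · exact ⟨0, by rw [map_zero, map_mul, Ideal.Quotient.eq_zero_iff_mem.2 (X_mem_orderIdeal.2 hv),
        mul_zero]⟩
    · exact ⟨a * X ⟨v, hv⟩, by rw [map_mul, map_mul, ha]; simp [φ]⟩

/-- The bottom prime of a chain contains some P_C^s, hence P_C, so the whole chain lives over P_C.
-/
theorem ringKrullDim_quotient_inf_orderIdeal_le (h𝒞 : ∀ C ∈ 𝒞, h ≤ C.card) :
    ringKrullDim (MvPolynomial V K ⧸ 𝒞.inf fun C => orderIdeal K C s) ≤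
      ((Fintype.card V - h : ℕ) : WithBot ℕ∞) := by
  rw [ringKrullDim_quotient]
  refine iSup_le fun p => ?_
  have hp : (𝒞.inf fun C => orderIdeal K C s) ≤ p.head.1.asIdeal := p.head.2
  obtain ⟨C, hC, hCp⟩ := p.head.1.isPrime.inf_le'.1 hp
  have hle : orderIdeal K C 1 ≤ p.head.1.asIdeal :=
    p.head.1.isPrime.le_of_pow_le (orderIdeal_one_pow_le.trans hCp)
  let q : LTSeries (PrimeSpectrum.zeroLocus (orderIdeal K C 1 : Set (MvPolynomial V K))) :=
    { length := p.length
      toFun := fun i => ⟨(p i).1, hle.trans (p.head_le i)⟩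
      step := p.step }
  have hq : ((p.length : ℕ) : WithBot ℕ∞) ≤ ((Fintype.card V - C.card : ℕ) : WithBot ℕ∞) := by
    refine le_trans ?_ (ringKrullDim_quotient_orderIdeal_one_le (K := K) C)
    rw [ringKrullDim_quotient]
    exact le_iSup (fun r : LTSeries (PrimeSpectrum.zeroLocus
      (orderIdeal K C 1 : Set (MvPolynomial V K))) => ((r.length : ℕ) : WithBot ℕ∞)) q
  refine hq.trans ?_
  have := h𝒞 C hC
  exact_mod_cast Nat.sub_le_sub_left this _

/-- Killing the variables in C maps the quotient onto a polynomial ring in the others. -/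
theorem le_ringKrullDim_quotient_inf_orderIdeal {C : Finset V} (hC : C ∈ 𝒞) (hs : 1 ≤ s) :
    ((Fintype.card V - C.card : ℕ) : WithBot ℕ∞) ≤
      ringKrullDim (MvPolynomial V K ⧸ 𝒞.inf fun C => orderIdeal K C s) := by
  classical
  rw [← ringKrullDim_compl (K := K)]
  let φ : MvPolynomial V K →ₐ[K] MvPolynomial {v // v ∉ C} K :=
    aeval fun v => if hv : v ∈ C then 0 else X ⟨v, hv⟩
  have hφ : ∀ f ∈ 𝒞.inf fun C => orderIdeal K C s, φ.toRingHom f = 0 := by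
    intro f hf
    have h1 := Finset.inf_le (f := fun C => orderIdeal K C s) hC hf
    have h2 : f ∈ Ideal.span (X '' (C : Set V) : Set (MvPolynomial V K)) := by
      rw [orderIdeal_eq_span_pow] at h1
      exact Ideal.pow_le_self (by omega) h1
    refine (Ideal.span_le (I := RingHom.ker φ.toRingHom)).2 ?_ h2
    rintro _ ⟨v, hv, rfl⟩
    change φ (X v) = 0
    have hv' : v ∈ C := hv
    simp [φ, hv']
  refine ringKrullDim_le_of_surjective (Ideal.Quotient.lift _ φ.toRingHom hφ) ?_
  refine Ideal.Quotient.lift_surjective_of_surjective _ _ fun g => ⟨rename Subtype.val g, ?_⟩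
  change φ (rename Subtype.val g) = g
  rw [aeval_rename, show (fun v => if hv : v ∈ C then 0 else X ⟨v, hv⟩) ∘ Subtype.val =
    (X : {v // v ∉ C} → MvPolynomial {v // v ∉ C} K) from
      _root_.funext fun v => dif_neg v.2,
    aeval_X_left_apply]

theorem moduleDim_quotient_inf_orderIdeal (h𝒞 : ∀ C ∈ 𝒞, h ≤ C.card)
    (hex : ∃ C ∈ 𝒞, C.card = h) (hs : 1 ≤ s) :
    moduleDim (MvPolynomial V K) (MvPolynomial V K ⧸ 𝒞.inf fun C => orderIdeal K C s) =
      Fintype.card V - h := by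
  obtain ⟨C, hC, rfl⟩ := hex
  rw [moduleDim, Module.supportDim_quotient_eq_ringKrullDim,
    le_antisymm (ringKrullDim_quotient_inf_orderIdeal_le h𝒞)
      (le_ringKrullDim_quotient_inf_orderIdeal hC hs)]
  rfl

theorem hasMultiplicity_symbolicPower (h𝒞 : IsAntichain (· ⊆ ·) (𝒞 : Set (Finset V)))
    (hle : ∀ C ∈ 𝒞, h ≤ C.card) (hex : 𝒞.Nonempty → ∃ C ∈ 𝒞, C.card = h) (hs : 1 ≤ s) :
    HasMultiplicity (σ := V)
      (quotientGrading (symbolicPower (𝒞.inf fun C => orderIdeal K C 1) s))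
      ((h + s - 1).choose h * (𝒞.filter fun C => C.card = h).card : ℕ) := by
  classical
  rw [symbolicPower_inf_orderIdeal h𝒞]
  obtain rfl | hne := 𝒞.eq_empty_or_nonempty
  -- An empty family gives the unit ideal and the zero module, as for the cover ideal of an edgeless
  -- graph.
  · refine ⟨0, ?_, by simp⟩
    rw [hilbertSeries_inf_orderIdeal]
    simp
  · exact hasMultiplicity_inf_orderIdeal hle hs (moduleDim_quotient_inf_orderIdeal hle (hex hne) hs)

end Dimension

/-- Membership of a monomial depends only on its support on either side; `hdual` says that the sets
containing a member of 𝒲 are the transversals of 𝒞. -/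
theorem span_prod_X_eq_inf_orderIdeal {K : Type*} [Field K] {V : Type*} [Fintype V]
    {𝒲 : Set (Finset V)} {𝒞 : Finset (Finset V)}
    (hdual : ∀ T : Finset V, (∃ w ∈ 𝒲, w ⊆ T) ↔ ∀ C ∈ 𝒞, ∃ v ∈ C, v ∈ T) :
    Ideal.span {f : MvPolynomial V K | ∃ w ∈ 𝒲, f = ∏ v ∈ w, X v} =
      𝒞.inf fun C => orderIdeal K C 1 := by
  classical
  have hset : {f : MvPolynomial V K | ∃ w ∈ 𝒲, f = ∏ v ∈ w, X v} =
      (fun m => monomial m (1 : K)) '' ((fun w => ∑ v ∈ w, Finsupp.single v 1) '' 𝒲) := by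
    ext f
    simp only [Set.mem_ofPred_eq, Set.mem_image, exists_exists_and_eq_and, monomial_sum_one]
    exact exists_congr fun w => and_congr_right fun _ => eq_comm
  ext f
  rw [hset, mem_ideal_span_monomial_image, mem_inf_orderIdeal]
  refine forall_congr' fun m => ?_
  have hle : ∀ w : Finset V, ∑ v ∈ w, Finsupp.single v 1 ≤ m ↔ w ⊆ m.support := by
    intro w
    rw [Finsupp.le_def]
    refine forall_congr' fun v => ?_
    simp only [Finsupp.finsetSum_apply, Finsupp.single_apply, Finset.sum_ite_eq',
      Finsupp.mem_support_iff]
    split_ifs with hv <;> simp [hv, Nat.one_le_iff_ne_zero]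
  have h1 : (∃ x ∈ (fun w : Finset V => ∑ v ∈ w, Finsupp.single v 1) '' 𝒲, x ≤ m) ↔
      ∀ C ∈ 𝒞, ∃ v ∈ C, v ∈ m.support := by
    rw [← hdual]
    simp [hle]
  have h2 : (∃ C ∈ 𝒞, ∑ v ∈ C, m v < 1) ↔ ¬ ∀ C ∈ 𝒞, ∃ v ∈ C, v ∈ m.support := by
    simp
  rw [h1, h2, mem_support_iff]
  tauto

end MvPolynomial

/-! ### Edge and cover ideals as intersections of primes. -/

namespace SimpleGraph

variable {V : Type*} [Fintype V] (G : SimpleGraph V)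

open Classical in
/-- The minimal vertex covers of a finite graph. -/
noncomputable def minimalCovers : Finset (Finset V) :=
  Finset.univ.filter fun w => Minimal G.IsVertexCover (w : Set V)

open Classical in
/-- The edges of a finite graph, as sets of two vertices. -/
noncomputable def edgePairs : Finset (Finset V) :=
  Finset.univ.filter fun e => ∃ i j, G.Adj i j ∧ e = {i, j}

variable {G}

theorem mem_minimalCovers {w : Finset V} :
    w ∈ G.minimalCovers ↔ Minimal G.IsVertexCover (w : Set V) := by
  simp [minimalCovers]

theorem mem_edgePairs [DecidableEq V] {e : Finset V} :
    e ∈ G.edgePairs ↔ ∃ i j, G.Adj i j ∧ e = {i, j} := by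
  simp only [edgePairs, Finset.mem_filter, Finset.mem_univ, true_and]
  convert Iff.rfl

theorem card_of_mem_edgePairs {e : Finset V} (he : e ∈ G.edgePairs) : e.card = 2 := by
  classical
  obtain ⟨i, j, hij, rfl⟩ := mem_edgePairs.1 he
  exact Finset.card_pair hij.ne

theorem IsVertexCover.exists_minimalCovers {T : Set V} (hT : G.IsVertexCover T) :
    ∃ w ∈ G.minimalCovers, (w : Set V) ⊆ T := by
  classical
  obtain ⟨C, hCT, hC⟩ := exists_minimal_le_of_wellFoundedLT G.IsVertexCover T hT
  exact ⟨C.toFinset, by rw [mem_minimalCovers, Set.coe_toFinset]; exact hC,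
    by rw [Set.coe_toFinset]; exact hCT⟩

theorem isAntichain_minimalCovers :
    IsAntichain (· ⊆ ·) (G.minimalCovers : Set (Finset V)) := by
  intro C hC D hD hne hsub
  have hC' := mem_minimalCovers.1 hC
  have hD' := mem_minimalCovers.1 hD
  refine hne (Finset.Subset.antisymm hsub ?_)
  exact_mod_cast hD'.2 hC'.1 (Finset.coe_subset.2 hsub)

theorem isAntichain_edgePairs : IsAntichain (· ⊆ ·) (G.edgePairs : Set (Finset V)) := by
  intro C hC D hD hne hsub
  refine hne (Finset.eq_of_subset_of_card_le hsub ?_)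
  rw [card_of_mem_edgePairs hC, card_of_mem_edgePairs hD]

theorem edgeIdeal_eq_inf (K : Type*) [Field K] :
    G.edgeIdeal K = G.minimalCovers.inf fun C => MvPolynomial.orderIdeal K C 1 := by
  classical
  rw [← MvPolynomial.span_prod_X_eq_inf_orderIdeal (𝒲 := {e | e ∈ G.edgePairs}), edgeIdeal]
  · congr 1
    ext f
    constructor
    · rintro ⟨i, j, hij, rfl⟩
      exact ⟨{i, j}, mem_edgePairs.2 ⟨i, j, hij, rfl⟩, (Finset.prod_pair hij.ne).symm⟩
    · rintro ⟨e, he, rfl⟩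
      obtain ⟨i, j, hij, rfl⟩ := mem_edgePairs.1 he
      exact ⟨i, j, hij, Finset.prod_pair hij.ne⟩
  · intro T
    constructor
    · rintro ⟨e, he, heT⟩ C hC
      obtain ⟨i, j, hij, rfl⟩ := mem_edgePairs.1 he
      obtain h | h := (mem_minimalCovers.1 hC).1 hij
      · exact ⟨i, h, heT (by simp)⟩
      · exact ⟨j, h, heT (by simp)⟩
    -- If T contains no edge, its complement is a cover and contains a minimal one, which misses T.
    · intro h
      by_contra hT
      have hcov : G.IsVertexCover ((T : Set V)ᶜ) := by
        intro i j hij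
        by_contra! hcon
        simp only [Set.mem_compl_iff, not_not, Finset.mem_coe] at hcon
        refine hT ⟨{i, j}, mem_edgePairs.2 ⟨i, j, hij, rfl⟩, ?_⟩
        rw [Finset.insert_subset_iff, Finset.singleton_subset_iff]
        exact hcon
      obtain ⟨w, hw, hwT⟩ := hcov.exists_minimalCovers
      obtain ⟨v, hvw, hvT⟩ := h w hw
      exact hwT hvw hvT

/-- The sets meeting every edge are the vertex covers, that is, the sets containing a minimal cover.
-/
theorem coverIdeal_eq_inf (K : Type*) [Field K] :
    G.coverIdeal K = G.edgePairs.inf fun C => MvPolynomial.orderIdeal K C 1 := by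
  classical
  rw [coverIdeal, ← MvPolynomial.span_prod_X_eq_inf_orderIdeal
    (𝒲 := {w | Minimal G.IsVertexCover (w : Set V)})]
  · rfl
  · intro T
    constructor
    · rintro ⟨w, hw, hwT⟩ e he
      obtain ⟨i, j, hij, rfl⟩ := mem_edgePairs.1 he
      obtain h | h := hw.1 hij
      · exact ⟨i, by simp, hwT h⟩
      · exact ⟨j, by simp, hwT h⟩
    · intro h
      have hcov : G.IsVertexCover (T : Set V) := by
        intro i j hij
        obtain ⟨v, hv, hvT⟩ := h {i, j} (mem_edgePairs.2 ⟨i, j, hij, rfl⟩)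
        rw [Finset.mem_insert, Finset.mem_singleton] at hv
        obtain rfl | rfl := hv
        · exact Or.inl hvT
        · exact Or.inr hvT
      obtain ⟨w, hw, hwT⟩ := hcov.exists_minimalCovers
      exact ⟨w, mem_minimalCovers.1 hw, Finset.coe_subset.1 hwT⟩

theorem card_edgePairs : G.edgePairs.card = G.edgeSet.ncard := by
  classical
  have h : (G.edgePairs : Set (Finset V)) = Sym2.toFinset '' G.edgeSet := by
    ext e
    rw [Finset.mem_coe, mem_edgePairs]
    constructor
    · rintro ⟨i, j, hij, rfl⟩
      exact ⟨s(i, j), hij, by ext; simp⟩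
    · rintro ⟨x, hx, rfl⟩
      induction x with
      | h i j => exact ⟨i, j, hx, by ext; simp⟩
  rw [← Set.ncard_coe_finset, h, Set.ncard_image_of_injective]
  intro x y hxy
  refine Sym2.ext fun v => ?_
  rw [← Sym2.mem_toFinset, hxy, Sym2.mem_toFinset]

theorem card_filter_minimalCovers (h : ℕ) :
    (G.minimalCovers.filter fun C => C.card = h).card =
      {C : Set V | Minimal G.IsVertexCover C ∧ C.ncard = h}.ncard := by
  classical
  have key : {C : Set V | Minimal G.IsVertexCover C ∧ C.ncard = h} =
      (fun w : Finset V => (w : Set V)) ''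
        (G.minimalCovers.filter fun C => C.card = h : Finset (Finset V)) := by
    ext C
    simp only [Set.mem_ofPred_eq, Set.mem_image, Finset.mem_coe, Finset.mem_filter,
      mem_minimalCovers]
    constructor
    · rintro ⟨hC, rfl⟩
      exact ⟨C.toFinset, ⟨by rwa [Set.coe_toFinset], by rw [Set.ncard_eq_toFinset_card']⟩,
        Set.coe_toFinset C⟩
    · rintro ⟨w, ⟨hw, rfl⟩, rfl⟩
      exact ⟨hw, Set.ncard_coe_finset w⟩
  rw [key, Set.ncard_image_of_injective _ Finset.coe_injective, Set.ncard_coe_finset]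

theorem le_card_of_mem_minimalCovers {h : ℕ} (hh : G.vertexCoverNum = (h : ℕ∞)) {C : Finset V}
    (hC : C ∈ G.minimalCovers) : h ≤ C.card := by
  have := (mem_minimalCovers.1 hC).1.vertexCoverNum_le
  rw [hh, Set.encard_coe_eq_coe_finsetCard] at this
  exact_mod_cast this

theorem exists_mem_minimalCovers_card_eq {h : ℕ} (hh : G.vertexCoverNum = (h : ℕ∞)) :
    ∃ C ∈ G.minimalCovers, C.card = h := by
  obtain ⟨T, hT, hcov⟩ := G.vertexCoverNum_exists
  obtain ⟨C, hC, hCT⟩ := hcov.exists_minimalCovers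
  refine ⟨C, hC, le_antisymm ?_ (le_card_of_mem_minimalCovers hh hC)⟩
  have := Set.encard_le_encard hCT
  rw [hT, hh, Set.encard_coe_eq_coe_finsetCard] at this
  exact_mod_cast this

end SimpleGraph

theorem corollary5p3 {K : Type*} [Field K] {V : Type*} [Finite V] (G : SimpleGraph V)
    (h : ℕ) (hh : G.vertexCoverNum = (h : ℕ∞)) (s : ℕ) (hs : 1 ≤ s) :
    HasMultiplicity (σ := V) (quotientGrading (symbolicPower (G.edgeIdeal K) s))
      ((h + s - 1).choose h *
        {C : Set V | Minimal G.IsVertexCover C ∧ C.ncard = h}.ncard : ℕ) ∧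
    HasMultiplicity (σ := V) (quotientGrading (symbolicPower (G.coverIdeal K) s))
      ((s + 1).choose 2 * G.edgeSet.ncard : ℕ) := by
  have := Fintype.ofFinite V
  constructor
  · rw [SimpleGraph.edgeIdeal_eq_inf, ← SimpleGraph.card_filter_minimalCovers]
    exact MvPolynomial.hasMultiplicity_symbolicPower SimpleGraph.isAntichain_minimalCovers
      (fun C hC => SimpleGraph.le_card_of_mem_minimalCovers hh hC)
      (fun _ => SimpleGraph.exists_mem_minimalCovers_card_eq hh) hs
  · have key := MvPolynomial.hasMultiplicity_symbolicPower (K := K)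
      (SimpleGraph.isAntichain_edgePairs (G := G))
      (fun C hC => (SimpleGraph.card_of_mem_edgePairs hC).ge)
      (fun ⟨C, hC⟩ => ⟨C, hC, SimpleGraph.card_of_mem_edgePairs hC⟩) hs
    rw [Finset.filter_true_of_mem fun C hC => SimpleGraph.card_of_mem_edgePairs hC,
      SimpleGraph.card_edgePairs, ← SimpleGraph.coverIdeal_eq_inf,
      show 2 + s - 1 = s + 1 by omega] at key
    exact key
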